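/- **Setting.** Let $I=[0,1]$ and let $\mathrm{Homeo}^+(I)$ be the group of orientation-preserving homeomorphisms of $I$. Given a group $H$ with an ordered generating tuple $(h_1,\dots,h_n)$, a *square root* of the marked group $(H;h_1,\dots,h_n)$ is a subgroup $K=\langle g_1,\dots,g_n\rangle<\mathrm{Homeo}^+(I)$ such that $g_i^2\mapsto h_i$ ($1\le i\le n$) defines an isomorphism $\langle g_1^2,\dots,g_n^2\rangle\cong H$. Let $F=\langle a,b\mid [ab^{-1},a^{-1}ba],\,[ab^{-1},a^{-2}ba^2]\rangle$ be Thompson's group, let $p_1,p_2$ and $q_1,q_2$ be the generators $a,b$ of two copies of $F$, and let $P$ be the subgroup of $F\times F$ generated by $(p_1,q_2)$ and $(p_2,q_1)$. A *marked extension* of $P$ is a group $G=\langle h_1,h_2\rangle$ that admits a surjective homomorphism $G\to P$ with $h_1\mapsto(p_1,q_2)$ and $h_2\mapsto(p_2,q_1)$. A group is *left orderable* if it admits a left-invariant total order. Let $L=\mathbb Z\wr\mathbb Z=\big(\bigoplus_{i\in\mathbb Z}\mathbb Z\big)\rtimes\mathbb Z$ be the lamplighter group, where $\mathbb Z$ acts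 by translating the index $i$, with its standard generators: the generator of the $0$-th summand, and the generator of the acting copy of $\mathbb Z$. **Theorem.** (1) For every left orderable marked extension $G$ of $P$, there exists a square root of $L$ (with its standard generators) that contains a subgroup isomorphic to $G$. (2) The square roots of $L$ (with its standard generators) fall into uncountably many isomorphism types of groups. -/

import Mathlib

open scoped commutatorElement

/-- `Homeo⁺(I)`: the group, under composition, of orientation-preserving (that is, increasing)
self-homeomorphisms of the unit interval `I = [0,1]`. -/
def HomeoPlusI : Subgroup (unitInterval ≃ₜ unitInterval) where
  carrier := {f | StrictMono f}
  mul_mem' {f g} hf hg := fun _ _ h => hf (hg h)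
  one_mem' := fun _ _ h => h
  inv_mem' {f} hf := by
    intro x y hxy
    by_contra hcon
    have h : f (f⁻¹ y) ≤ f (f⁻¹ x) := hf.monotone (not_lt.mp hcon)
    have hx : f (f⁻¹ x) = x := f.apply_symm_apply x
    have hy : f (f⁻¹ y) = y := f.apply_symm_apply y
    rw [hx, hy] at h
    exact absurd hxy (not_lt.mpr h)

/-- The relators of Thompson's group `F` in the presentation
`⟨a, b ∣ [ab⁻¹, a⁻¹ba], [ab⁻¹, a⁻²ba²]⟩`, with `a = of 0` and `b = of 1`. -/
def thompsonRelators : Set (FreeGroup (Fin 2)) :=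
  let a := FreeGroup.of (0 : Fin 2)
  let b := FreeGroup.of (1 : Fin 2)
  {⁅a * b⁻¹, a⁻¹ * b * a⁆, ⁅a * b⁻¹, (a ^ 2)⁻¹ * b * a ^ 2⁆}

/-- Thompson's group `F`. -/
abbrev ThompsonF : Type := PresentedGroup thompsonRelators

/-- The two standard generators of `F`. -/
def thompsonGen (i : Fin 2) : ThompsonF := PresentedGroup.of i

/-- The element `(p₁, q₂)` of `F × F`. -/
def pairOne : ThompsonF × ThompsonF := (thompsonGen 0, thompsonGen 1)

/-- The element `(p₂, q₁)` of `F × F`. -/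
def pairTwo : ThompsonF × ThompsonF := (thompsonGen 1, thompsonGen 0)

/-- The subgroup `P` of `F × F` generated by `(p₁, q₂)` and `(p₂, q₁)`. -/
def groupP : Subgroup (ThompsonF × ThompsonF) := Subgroup.closure {pairOne, pairTwo}

/-- The group `G`, with its ordered pair `(h₁, h₂)` of distinguished elements, is a marked
extension of `P`: `h₁, h₂` generate `G` and there is a surjective homomorphism `G → P` with
`h₁ ↦ (p₁, q₂)` and `h₂ ↦ (p₂, q₁)`. -/
def IsMarkedExtensionOfP {G : Type*} [Group G] (h₁ h₂ : G) : Prop :=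
  Subgroup.closure {h₁, h₂} = (⊤ : Subgroup G) ∧
    ∃ π : G →* groupP, Function.Surjective π ∧
      (π h₁ : ThompsonF × ThompsonF) = pairOne ∧ (π h₂ : ThompsonF × ThompsonF) = pairTwo

/-- A group is left orderable if it carries a left-invariant total order. -/
def IsLeftOrderable (G : Type*) [Group G] : Prop :=
  ∃ _ : LinearOrder G, ∀ a b c : G, b < c → a * b < a * c

/-- The translation action of `ℤ` on `⨁_{i ∈ ℤ} ℤ`: the integer `n` sends the `i`-th summand to
the `(i+n)`-th summand. -/
noncomputable def lampShift : Multiplicative ℤ →* MulAut (Multiplicative (ℤ →₀ ℤ)) where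
  toFun n := AddEquiv.toMultiplicative (Finsupp.domCongr (Equiv.addRight n.toAdd))
  map_one' := by
    refine MulEquiv.ext fun f => Finsupp.ext fun i => ?_
    change f.toAdd (i - 0) = f.toAdd i
    rw [sub_zero]
  map_mul' m n := by
    refine MulEquiv.ext fun f => Finsupp.ext fun i => ?_
    change f.toAdd (i - (m.toAdd + n.toAdd)) = f.toAdd (i - m.toAdd - n.toAdd)
    rw [sub_sub]

/-- The lamplighter group `L = ℤ ≀ ℤ = (⨁_{i ∈ ℤ} ℤ) ⋊ ℤ` (restricted wreath product). -/
abbrev Lamplighter : Type := Multiplicative (ℤ →₀ ℤ) ⋊[lampShift] Multiplicative ℤ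

/-- The standard generators of `L`: the generator of the `0`-th copy of `ℤ` in `⨁_{i ∈ ℤ} ℤ`, and
the generator of the acting copy of `ℤ`. -/
noncomputable def lampGen : Fin 2 → Lamplighter :=
  ![SemidirectProduct.inl (Multiplicative.ofAdd (Finsupp.single 0 1)),
    SemidirectProduct.inr (Multiplicative.ofAdd 1)]

/-- The subgroup `K` of `Homeo⁺(I)` is a square root of the marked group `(H; h₁, …, hₙ)`:
`K` is generated by elements `g₁, …, gₙ` such that `⟨g₁², …, gₙ²⟩` is isomorphic to `H`, by an
isomorphism with `gᵢ² ↦ hᵢ`. -/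
def IsSquareRoot {n : ℕ} {H : Type*} [Group H] (h : Fin n → H) (K : Subgroup HomeoPlusI) : Prop :=
  ∃ g : Fin n → HomeoPlusI, Subgroup.closure (Set.range g) = K ∧
    ∃ e : Subgroup.closure (Set.range fun i => g i ^ 2) ≃* H,
      ∀ i, e ⟨g i ^ 2, Subgroup.subset_closure (Set.mem_range_self i)⟩ = h i

/-- The square roots in `Homeo⁺(I)` of `(H; h₁, …, hₙ)`, up to isomorphism of groups. -/
def squareRootIso {n : ℕ} {H : Type*} [Group H] (h : Fin n → H) :
    Setoid {K : Subgroup HomeoPlusI // IsSquareRoot h K} where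
  r K K' := Nonempty (K.1 ≃* K'.1)
  iseqv :=
    { refl := fun K => ⟨MulEquiv.refl K.1⟩
      symm := fun ⟨e⟩ => ⟨e.symm⟩
      trans := fun ⟨e⟩ ⟨e'⟩ => ⟨e.trans e'⟩ }

/-! Order automorphisms of a countable linear order act faithfully on `I`, so everything can be
built on `ℤ ×ₗ X`, a chain of cells. Let `g` shift the cells by one and let `f` preserve each cell,
acting by powers of `α` on even cells and of `β` on odd ones, with exponents `a`. Conjugation by `g
^ 2` preserves parity, so the conjugates of `f ^ 2` by powers of `g ^ 2` commute. If `α` has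
infinite order and `a` restricted to even integers is the indicator of `0`, then `f ^ 2` and `g ^ 2`
generate a copy of `L` (`lampRep_injective`). The exponents on odd cells and `β` remain free.

For (1), take `X = G`, with `α`, `β` the left translations by `h₁`, `h₂`. On cell 1, `g * f * g⁻¹`
and `f` act as `h₁` and `h₂`; elsewhere they act through powers of `h₁` or `h₂` alone, which the
abelianization of `F` controls.

For (2), odd exponents encode a set `S ⊆ ℕ`, recovered from which odd conjugates of `f` commute with
`f`. A countable group has only countably many pairs `(f, g)`, so countably many types cannot
realize every `S`. -/

/-! ### From order automorphisms to homeomorphisms of the interval. -/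

theorem exists_strictMono_dense_unitInterval (Y : Type*) [LinearOrder Y] [Countable Y]
    [DenselyOrdered Y] [NoMinOrder Y] [NoMaxOrder Y] [Nonempty Y] :
    ∃ ι : Y → unitInterval, StrictMono ι ∧ ∀ x y, x < y → ∃ d, x < ι d ∧ ι d < y := by
  have : Nonempty (Set.Ioo (0 : ℚ) 1) := ⟨⟨1 / 2, by norm_num, by norm_num⟩⟩
  obtain ⟨e⟩ := Order.iso_of_countable_dense Y (Set.Ioo (0 : ℚ) 1)
  refine ⟨fun d => ⟨((e d : ℚ) : ℝ), by exact_mod_cast (e d).2.1.le,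
    by exact_mod_cast (e d).2.2.le⟩, fun d d' h => ?_, fun x y hxy => ?_⟩
  · have : (e d : ℚ) < e d' := e.strictMono h
    exact Subtype.mk_lt_mk.2 (by exact_mod_cast this)
  · obtain ⟨q, h1, h2⟩ := exists_rat_btwn (show (x : ℝ) < y from hxy)
    have h0 : (0 : ℝ) < q := x.2.1.trans_lt h1
    have h3 : (q : ℝ) < 1 := h2.trans_le y.2.2
    obtain ⟨d, hd⟩ := e.surjective ⟨q, by exact_mod_cast h0, by exact_mod_cast h3⟩
    have hq : ((e d : ℚ) : ℝ) = q := by rw [hd]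
    exact ⟨d, h1.trans_eq hq.symm, hq.trans_lt h2⟩

section DenseExtension

theorem eq_of_forall_lt_iff_of_dense {Y J : Type*} [LinearOrder J] {ι : Y → J}
    (hd : ∀ x y, x < y → ∃ d, x < ι d ∧ ι d < y) {x y : J} (h : ∀ d, ι d < x ↔ ι d < y) : x = y := by
  rcases lt_trichotomy x y with hxy | hxy | hxy
  · obtain ⟨d, h1, h2⟩ := hd x y hxy
    exact absurd ((h d).2 h2) h1.not_gt
  · exact hxy
  · obtain ⟨d, h1, h2⟩ := hd y x hxy
    exact absurd ((h d).1 h2) h1.not_gt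

variable {Y J : Type*} [LinearOrder Y] [CompleteLinearOrder J] {ι : Y → J}

/-- The extension of an order automorphism `σ` of `Y` along a dense embedding `ι` of `Y`. -/
noncomputable def denseExtend (ι : Y → J) (σ : Y ≃o Y) (x : J) : J :=
  sSup ((fun d => ι (σ d)) '' {d | ι d < x})

/-- Points of `J` are determined by their cuts in `Y`, so this description of the cut makes the
extension functorial. -/
theorem lt_denseExtend_iff (hι : StrictMono ι) (hd : ∀ x y, x < y → ∃ d, x < ι d ∧ ι d < y)
    (σ : Y ≃o Y) (x : J) (d : Y) :
    ι (σ d) < denseExtend ι σ x ↔ ι d < x := by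
  constructor
  · intro h
    obtain ⟨_, ⟨d', hd', rfl⟩, hlt⟩ := lt_sSup_iff.1 h
    exact (hι (σ.lt_iff_lt.1 (hι.lt_iff_lt.1 hlt))).trans hd'
  · intro h
    obtain ⟨d', h1, h2⟩ := hd _ _ h
    exact (hι (σ.strictMono (hι.lt_iff_lt.1 h1))).trans_le (le_sSup ⟨d', h2, rfl⟩)

theorem denseExtend_one (hι : StrictMono ι) (hd : ∀ x y, x < y → ∃ d, x < ι d ∧ ι d < y) (x : J) :
    denseExtend ι 1 x = x :=
  eq_of_forall_lt_iff_of_dense hd fun d => lt_denseExtend_iff hι hd 1 x d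

theorem denseExtend_mul (hι : StrictMono ι) (hd : ∀ x y, x < y → ∃ d, x < ι d ∧ ι d < y)
    (σ τ : Y ≃o Y) (x : J) :
    denseExtend ι (σ * τ) x = denseExtend ι σ (denseExtend ι τ x) := by
  refine eq_of_forall_lt_iff_of_dense hd fun d => ?_
  obtain ⟨d, rfl⟩ := (σ * τ).surjective d
  rw [lt_denseExtend_iff hι hd, RelIso.mul_apply, lt_denseExtend_iff hι hd,
    lt_denseExtend_iff hι hd]

theorem denseExtend_apply (hι : StrictMono ι) (hd : ∀ x y, x < y → ∃ d, x < ι d ∧ ι d < y)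
    (σ : Y ≃o Y) (y : Y) : denseExtend ι σ (ι y) = ι (σ y) := by
  refine eq_of_forall_lt_iff_of_dense hd fun d => ?_
  obtain ⟨d, rfl⟩ := σ.surjective d
  rw [lt_denseExtend_iff hι hd, hι.lt_iff_lt, hι.lt_iff_lt, σ.lt_iff_lt]

theorem denseExtend_mono (σ : Y ≃o Y) : Monotone (denseExtend ι σ) := fun _ _ h =>
  sSup_le_sSup (Set.image_mono fun _ hd => lt_of_lt_of_le hd h)

/-- Extension along a dense embedding, as a homomorphism. -/
noncomputable def denseExtendHom (hι : StrictMono ι)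
    (hd : ∀ x y, x < y → ∃ d, x < ι d ∧ ι d < y) : (Y ≃o Y) →* (J ≃o J) where
  toFun σ :=
    { toFun := denseExtend ι σ
      invFun := denseExtend ι σ⁻¹
      left_inv := fun x => by
        rw [← denseExtend_mul hι hd, inv_mul_cancel, denseExtend_one hι hd]
      right_inv := fun x => by
        rw [← denseExtend_mul hι hd, mul_inv_cancel, denseExtend_one hι hd]
      map_rel_iff' := fun {x y} => by
        refine ⟨fun h => ?_, fun h => denseExtend_mono σ h⟩
        have := denseExtend_mono (ι := ι) σ⁻¹ h
        simpa [← denseExtend_mul hι hd, denseExtend_one hι hd] using this }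
  map_one' := RelIso.ext fun x => denseExtend_one hι hd x
  map_mul' σ τ := RelIso.ext fun x => denseExtend_mul hι hd σ τ x

theorem denseExtendHom_injective (hι : StrictMono ι)
    (hd : ∀ x y, x < y → ∃ d, x < ι d ∧ ι d < y) : Function.Injective (denseExtendHom hι hd) := by
  intro σ τ h
  refine RelIso.ext fun y => hι.injective ?_
  rw [← denseExtend_apply hι hd, ← denseExtend_apply hι hd]
  exact DFunLike.congr_fun h (ι y)

end DenseExtension

/-- An order automorphism of the unit interval is an orientation-preserving homeomorphism. -/
def orderIsoToHomeoPlusI : (unitInterval ≃o unitInterval) →* HomeoPlusI where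
  toFun σ := ⟨σ.toHomeomorph, σ.strictMono⟩
  map_one' := rfl
  map_mul' _ _ := rfl

theorem orderIsoToHomeoPlusI_injective : Function.Injective orderIsoToHomeoPlusI := fun _ _ h =>
  RelIso.ext fun x => DFunLike.congr_fun (congrArg Subtype.val h) x

section Skew

variable {Y X : Type*} [LinearOrder Y] [LinearOrder X]

/-- The order automorphism of `Y ×ₗ X` that acts by `σ` on the base `Y` and by `c y` from the fibre
over `y` to the fibre over `σ y`. -/
def lexSkew (σ : Y ≃o Y) (c : Y → (X ≃o X)) : (Y ×ₗ X) ≃o (Y ×ₗ X) where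
  toFun p := toLex (σ (ofLex p).1, c (ofLex p).1 (ofLex p).2)
  invFun p := toLex (σ.symm (ofLex p).1, (c (σ.symm (ofLex p).1)).symm (ofLex p).2)
  left_inv p := by simp
  right_inv p := by simp
  map_rel_iff' {p q} := by
    simp only [Equiv.coe_fn_mk, Prod.Lex.le_iff, ofLex_toLex, σ.lt_iff_lt, σ.apply_eq_iff_eq]
    refine or_congr_right (and_congr_right fun h => ?_)
    rw [h, (c _).le_iff_le]

theorem lexSkew_mul (σ τ : Y ≃o Y) (c d : Y → (X ≃o X)) :
    lexSkew σ c * lexSkew τ d = lexSkew (σ * τ) (fun y => c (τ y) * d y) :=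
  RelIso.ext fun _ => rfl

theorem lexSkew_one : lexSkew (1 : Y ≃o Y) (1 : Y → (X ≃o X)) = 1 := rfl

theorem lexSkew_congr {σ τ : Y ≃o Y} {c d : Y → (X ≃o X)} (hσ : σ = τ) (hc : c = d) :
    lexSkew σ c = lexSkew τ d := by rw [hσ, hc]

theorem lexSkew_inj [Nonempty X] {σ τ : Y ≃o Y} {c d : Y → (X ≃o X)} :
    lexSkew σ c = lexSkew τ d ↔ σ = τ ∧ c = d := by
  refine ⟨fun h => ⟨RelIso.ext fun y => ?_, funext fun y => RelIso.ext fun x => ?_⟩, ?_⟩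
  · obtain ⟨x⟩ := ‹Nonempty X›
    exact congrArg (fun p => (ofLex p).1) (DFunLike.congr_fun h (toLex (y, x)))
  · exact congrArg (fun p => (ofLex p).2) (DFunLike.congr_fun h (toLex (y, x)))
  · exact fun h => lexSkew_congr h.1 h.2

end Skew

/-- The group of order automorphisms of a countable linear order acts faithfully on the unit
interval by orientation-preserving homeomorphisms. -/
theorem exists_injective_orderIso_to_homeoPlusI (Y : Type*) [LinearOrder Y] [Countable Y]
    [Nonempty Y] : ∃ φ : (Y ≃o Y) →* HomeoPlusI, Function.Injective φ := by
  -- The factor `ℚ` makes the order dense without endpoints, as Cantor's theorem requires.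
  have : Countable (Y ×ₗ ℚ) := inferInstanceAs (Countable (Y × ℚ))
  have : Nonempty (Y ×ₗ ℚ) := inferInstanceAs (Nonempty (Y × ℚ))
  obtain ⟨ι, hι, hd⟩ := exists_strictMono_dense_unitInterval (Y ×ₗ ℚ)
  let ψ : (Y ≃o Y) →* ((Y ×ₗ ℚ) ≃o (Y ×ₗ ℚ)) :=
    { toFun := fun σ => lexSkew σ 1
      map_one' := rfl
      map_mul' := fun _ _ => rfl }
  exact ⟨(orderIsoToHomeoPlusI.comp (denseExtendHom hι hd)).comp ψ,
    (orderIsoToHomeoPlusI_injective.comp (denseExtendHom_injective hι hd)).comp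
      fun _ _ h => (lexSkew_inj.1 h).1⟩

/-! ### The lamplighter group acting on a chain of cells. -/

section Cells

variable {X : Type*} [LinearOrder X]

/-- The automorphism of `ℤ ×ₗ X` that preserves each cell `{j} × X` and acts on it by `c j`. -/
def cellMap : (ℤ → (X ≃o X)) →* ((ℤ ×ₗ X) ≃o (ℤ ×ₗ X)) where
  toFun c := lexSkew 1 c
  map_one' := lexSkew_one
  map_mul' c d := (lexSkew_mul 1 1 c d).symm

/-- The automorphism of `ℤ ×ₗ X` that shifts the cells by `n`. -/
def cellShift (X : Type*) [LinearOrder X] : Multiplicative ℤ →* ((ℤ ×ₗ X) ≃o (ℤ ×ₗ X)) where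
  toFun n := lexSkew (OrderIso.addRight n.toAdd) 1
  map_one' := by
    rw [← lexSkew_one]
    exact lexSkew_congr (RelIso.ext fun y => add_zero y) rfl
  map_mul' m n := by
    rw [lexSkew_mul]
    refine lexSkew_congr (RelIso.ext fun y => ?_) rfl
    change y + (m.toAdd + n.toAdd) = y + n.toAdd + m.toAdd
    ring

theorem cellMap_injective [Nonempty X] : Function.Injective (cellMap (X := X)) :=
  fun _ _ h => (lexSkew_inj.1 h).2

theorem cellShift_mul_cellMap (n : Multiplicative ℤ) (c : ℤ → (X ≃o X)) :
    cellShift X n * cellMap c = cellMap (fun j => c (j - n.toAdd)) * cellShift X n := by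
  refine (lexSkew_mul _ _ _ _).trans (Eq.trans ?_ (lexSkew_mul _ _ _ _).symm)
  refine lexSkew_congr rfl (funext fun y => ?_)
  change 1 * c y = c (y + n.toAdd - n.toAdd) * 1
  rw [add_sub_cancel_right, one_mul, mul_one]

theorem cellShift_conj_cellMap (n : Multiplicative ℤ) (c : ℤ → (X ≃o X)) :
    cellShift X n * cellMap c * (cellShift X n)⁻¹ = cellMap (fun j => c (j - n.toAdd)) := by
  rw [cellShift_mul_cellMap, mul_inv_cancel_right]

/-- The sequence of automorphisms equal to `α` at even and to `β` at odd integers. -/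
def alternating (α β : X ≃o X) (j : ℤ) : X ≃o X := if Even j then α else β

theorem alternating_sub_two_mul (α β : X ≃o X) (j m : ℤ) :
    alternating α β (j - 2 * m) = alternating α β j := by
  simp [alternating, Int.even_sub]

/-- The cell map acting on the `j`-th cell by `α ^ a j` if `j` is even and by `β ^ a j` if `j` is
odd. -/
def alternatingCells (α β : X ≃o X) (a : ℤ → ℤ) : (ℤ ×ₗ X) ≃o (ℤ ×ₗ X) :=
  cellMap fun j => alternating α β j ^ a j

/-- The function `j ↦ ∑ i, n i * a (j - 2 * i)`, as a function of `n`. -/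
noncomputable def evenConv (a : ℤ → ℤ) (j : ℤ) : (ℤ →₀ ℤ) →ₗ[ℤ] ℤ :=
  Finsupp.linearCombination ℤ fun i => a (j - 2 * i)

/-- On even cells only one term of the convolution survives, so cell `2 * l` reads off the `l`-th
lamp. -/
theorem evenConv_two_mul {a : ℤ → ℤ} (ha : ∀ l, a (2 * l) = if l = 0 then 1 else 0) (l : ℤ)
    (n : ℤ →₀ ℤ) : evenConv a (2 * l) n = n l := by
  simp only [evenConv, Finsupp.linearCombination_apply, ← mul_sub, ha, sub_eq_zero]
  simp +contextual [eq_comm]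

theorem evenConv_lampShift (a : ℤ → ℤ) (j : ℤ) (m : Multiplicative ℤ)
    (n : Multiplicative (ℤ →₀ ℤ)) :
    evenConv a j (lampShift m n).toAdd = evenConv a (j - 2 * m.toAdd) n.toAdd := by
  change evenConv a j (Finsupp.domCongr (Equiv.addRight m.toAdd) n.toAdd) = _
  rw [Finsupp.domCongr_apply, Finsupp.equivMapDomain_eq_mapDomain, evenConv,
    Finsupp.linearCombination_mapDomain]
  refine DFunLike.congr_fun (congrArg (Finsupp.linearCombination ℤ) (funext fun i => ?_)) _
  change a (j - 2 * (i + m.toAdd)) = a (j - 2 * m.toAdd - 2 * i)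
  congr 1
  ring

/-- The homomorphism from the base of the lamplighter group that sends the `i`-th generator to the
square of `alternatingCells α β a` shifted by `2 * i`. -/
noncomputable def lampBaseRep (α β : X ≃o X) (a : ℤ → ℤ) :
    Multiplicative (ℤ →₀ ℤ) →* ((ℤ ×ₗ X) ≃o (ℤ ×ₗ X)) :=
  cellMap.comp
    { toFun := fun n j => alternating α β j ^ (2 * evenConv a j n.toAdd)
      map_one' := by
        funext j
        simp
      map_mul' := fun m n => by
        funext j
        simp [mul_add, zpow_add] }

theorem lampBaseRep_apply (α β : X ≃o X) (a : ℤ → ℤ) (n : Multiplicative (ℤ →₀ ℤ)) :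
    lampBaseRep α β a n = cellMap fun j => alternating α β j ^ (2 * evenConv a j n.toAdd) := rfl

theorem lampBaseRep_lampShift (α β : X ≃o X) (a : ℤ → ℤ) (m : Multiplicative ℤ)
    (n : Multiplicative (ℤ →₀ ℤ)) :
    lampBaseRep α β a (lampShift m n) =
      cellShift X (m ^ 2) * lampBaseRep α β a n * (cellShift X (m ^ 2))⁻¹ := by
  have h : (m ^ 2).toAdd = 2 * m.toAdd := by simp
  rw [lampBaseRep_apply, lampBaseRep_apply, cellShift_conj_cellMap, h]
  simp only [evenConv_lampShift, alternating_sub_two_mul]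

/-- The representation of the lamplighter group by squares of `alternatingCells α β a` and the
shift by one. -/
noncomputable def lampRep (α β : X ≃o X) (a : ℤ → ℤ) : Lamplighter →* ((ℤ ×ₗ X) ≃o (ℤ ×ₗ X)) :=
  SemidirectProduct.lift (lampBaseRep α β a) ((cellShift X).comp (powMonoidHom 2)) fun m =>
    MonoidHom.ext fun n => lampBaseRep_lampShift α β a m n

theorem lampRep_apply (α β : X ≃o X) (a : ℤ → ℤ) (x : Lamplighter) :
    lampRep α β a x = lexSkew (OrderIso.addRight (x.right ^ 2).toAdd) fun j =>
      alternating α β (j + (x.right ^ 2).toAdd) ^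
        (2 * evenConv a (j + (x.right ^ 2).toAdd) x.left.toAdd) :=
  RelIso.ext fun _ => rfl

theorem lampRep_lampGen_zero (α β : X ≃o X) (a : ℤ → ℤ) :
    lampRep α β a (lampGen 0) = alternatingCells α β a ^ 2 := by
  refine (SemidirectProduct.lift_inl _ _ _ _).trans ?_
  rw [alternatingCells, ← map_pow]
  refine congrArg cellMap (funext fun j => ?_)
  change alternating α β j ^ (2 * evenConv a j (Finsupp.single 0 1)) =
    (alternating α β j ^ a j) ^ 2
  rw [evenConv, Finsupp.linearCombination_single, one_smul, mul_zero, sub_zero, mul_comm, zpow_mul]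
  rfl

theorem lampRep_lampGen_one (α β : X ≃o X) (a : ℤ → ℤ) :
    lampRep α β a (lampGen 1) = cellShift X (Multiplicative.ofAdd 1) ^ 2 :=
  (SemidirectProduct.lift_inr _ _ _ _).trans (map_pow (cellShift X) _ _)

theorem lampRep_injective [Nonempty X] {α β : X ≃o X} {a : ℤ → ℤ}
    (hα : ∀ k : ℤ, α ^ k = 1 → k = 0) (ha : ∀ l, a (2 * l) = if l = 0 then 1 else 0) :
    Function.Injective (lampRep α β a) := by
  rw [injective_iff_map_eq_one]
  intro x hx
  rw [lampRep_apply, ← lexSkew_one, lexSkew_inj] at hx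
  obtain ⟨h1, h2⟩ := hx
  have hr : (x.right ^ 2).toAdd = 0 := by
    have := DFunLike.congr_fun h1 0
    change 0 + (x.right ^ 2).toAdd = 0 at this
    rwa [zero_add] at this
  refine SemidirectProduct.ext (Finsupp.ext fun l => ?_) ?_
  · have := congrFun h2 (2 * l)
    rw [hr, add_zero, evenConv_two_mul ha, alternating, if_pos (even_two_mul l)] at this
    have := hα _ this
    change x.left.toAdd l = 0
    lia
  · have : 2 * x.right.toAdd = 0 := by simpa using hr
    exact Multiplicative.toAdd.injective (by simpa using this)

end Cells

theorem closure_range_lampGen : Subgroup.closure (Set.range lampGen) = ⊤ := by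
  set C := Subgroup.closure (Set.range lampGen)
  have h0 : SemidirectProduct.inl (Multiplicative.ofAdd (Finsupp.single 0 1)) ∈ C :=
    Subgroup.subset_closure ⟨0, rfl⟩
  have h1 : SemidirectProduct.inr (Multiplicative.ofAdd 1) ∈ C :=
    Subgroup.subset_closure ⟨1, rfl⟩
  have hr (m : Multiplicative ℤ) : (SemidirectProduct.inr m : Lamplighter) ∈ C := by
    have h := C.zpow_mem h1 m.toAdd
    rwa [← map_zpow, ← ofAdd_zsmul, zsmul_one, Int.cast_id, ofAdd_toAdd] at h
  have hl (n : ℤ →₀ ℤ) : (SemidirectProduct.inl (Multiplicative.ofAdd n) : Lamplighter) ∈ C := by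
    induction n using Finsupp.induction_linear with
    | zero => exact C.one_mem
    | add m n hm hn =>
      rw [ofAdd_add, map_mul]
      exact C.mul_mem hm hn
    | single i k =>
      have h := C.zpow_mem (C.mul_mem (C.mul_mem (hr (Multiplicative.ofAdd i)) h0)
        (hr (Multiplicative.ofAdd i)⁻¹)) k
      rw [← SemidirectProduct.inl_aut, ← map_zpow] at h
      convert h using 2
      change Multiplicative.ofAdd (Finsupp.single i k) = Multiplicative.ofAdd
        (k • Finsupp.domCongr (Equiv.addRight i) (Finsupp.single 0 1))
      simp
  refine eq_top_iff.2 fun x _ => ?_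
  rw [← SemidirectProduct.inl_left_mul_inr_right x]
  exact C.mul_mem (hl _) (hr _)

theorem isSquareRoot_closure_range {n : ℕ} {H : Type*} [Group H] {h : Fin n → H}
    (hgen : Subgroup.closure (Set.range h) = ⊤) (g : Fin n → HomeoPlusI) (θ : H →* HomeoPlusI)
    (hθ : Function.Injective θ) (hg : ∀ i, θ (h i) = g i ^ 2) :
    IsSquareRoot h (Subgroup.closure (Set.range g)) := by
  have hr : θ.range = Subgroup.closure (Set.range fun i => g i ^ 2) := by
    rw [MonoidHom.range_eq_map, ← hgen, MonoidHom.map_closure, ← Set.range_comp]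
    exact congrArg (fun s => Subgroup.closure (Set.range s)) (funext hg)
  let e : H ≃* Subgroup.closure (Set.range fun i => g i ^ 2) :=
    (MonoidHom.ofInjective hθ).trans (MulEquiv.subgroupCongr hr)
  refine ⟨g, rfl, e.symm, fun i => ?_⟩
  rw [MulEquiv.symm_apply_eq]
  exact Subtype.ext (hg i).symm

theorem isSquareRoot_alternatingCells {X : Type*} [LinearOrder X] [Nonempty X] {α : X ≃o X}
    (β : X ≃o X) {a : ℤ → ℤ} (hα : ∀ k : ℤ, α ^ k = 1 → k = 0)
    (ha : ∀ l, a (2 * l) = if l = 0 then 1 else 0) (φ : ((ℤ ×ₗ X) ≃o (ℤ ×ₗ X)) →* HomeoPlusI)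
    (hφ : Function.Injective φ) :
    IsSquareRoot lampGen (Subgroup.closure (Set.range
      ![φ (alternatingCells α β a), φ (cellShift X (Multiplicative.ofAdd 1))])) := by
  refine isSquareRoot_closure_range closure_range_lampGen _ (φ.comp (lampRep α β a))
    (hφ.comp (lampRep_injective hα ha)) fun i => ?_
  fin_cases i
  · exact (congrArg φ (lampRep_lampGen_zero α β a)).trans (map_pow _ _ _)
  · exact (congrArg φ (lampRep_lampGen_one α β a)).trans (map_pow _ _ _)

/-! ### Embedding left orderable extensions. -/

/-- Left translation in a left ordered group, as an order automorphism. -/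
noncomputable def leftTranslation {G : Type*} [Group G] [LinearOrder G]
    (hG : ∀ a b c : G, b < c → a * b < a * c) : G →* (G ≃o G) where
  toFun a := StrictMono.orderIsoOfSurjective (fun x => a * x) (fun b c h => hG a b c h)
    (mul_left_surjective a)
  map_one' := RelIso.ext fun x => one_mul x
  map_mul' a b := RelIso.ext fun x => mul_assoc a b x

theorem leftTranslation_injective {G : Type*} [Group G] [LinearOrder G]
    (hG : ∀ a b c : G, b < c → a * b < a * c) : Function.Injective (leftTranslation hG) :=
  fun _ _ h => mul_right_cancel (b := 1) (DFunLike.congr_fun h 1)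

theorem countable_closure_range {ι Γ : Type*} [Countable ι] [Group Γ] (g : ι → Γ) :
    Countable (Subgroup.closure (Set.range g)) := by
  rw [← FreeGroup.range_lift_eq_closure]
  exact (FreeGroup.lift g).rangeRestrict_surjective.countable

/-- The abelianization `F → ℤ²` of Thompson's group. -/
def thompsonAb : ThompsonF →* Multiplicative (ℤ × ℤ) :=
  PresentedGroup.toGroup (f := ![Multiplicative.ofAdd (1, 0), Multiplicative.ofAdd (0, 1)])
    (by
      rintro r (rfl | rfl) <;>
      exact (map_commutatorElement _ _ _).trans (commutatorElement_eq_one_iff_mul_comm.2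
        (mul_comm _ _)))

/-- Projecting `P` to the first factor and abelianizing `F` is all that is needed of `P`. -/
theorem IsMarkedExtensionOfP.exists_hom_int {G : Type*} [Group G] {h₁ h₂ : G}
    (h : IsMarkedExtensionOfP h₁ h₂) : ∃ ε : G →* Multiplicative (ℤ × ℤ),
      ε h₁ = Multiplicative.ofAdd (1, 0) ∧ ε h₂ = Multiplicative.ofAdd (0, 1) := by
  obtain ⟨-, π, -, h1, h2⟩ := h
  refine ⟨thompsonAb.comp ((MonoidHom.fst _ _).comp (groupP.subtype.comp π)), ?_, ?_⟩
  · change thompsonAb (π h₁ : ThompsonF × ThompsonF).1 = _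
    rw [h1]
    exact PresentedGroup.toGroup.of _
  · change thompsonAb (π h₂ : ThompsonF × ThompsonF).1 = _
    rw [h2]
    exact PresentedGroup.toGroup.of _

theorem exists_squareRoot_lampGen_of_hom_int {G : Type*} [Group G] {h₁ h₂ : G}
    (hgen : Subgroup.closure {h₁, h₂} = (⊤ : Subgroup G)) (hG : IsLeftOrderable G)
    {ε : G →* Multiplicative (ℤ × ℤ)} (hε₁ : ε h₁ = Multiplicative.ofAdd (1, 0))
    (hε₂ : ε h₂ = Multiplicative.ofAdd (0, 1)) :
    ∃ K : Subgroup HomeoPlusI, IsSquareRoot lampGen K ∧ ∃ φ : G →* K, Function.Injective φ := by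
  obtain ⟨_, hlt⟩ := hG
  have : Countable G := by
    have h := countable_closure_range ![h₁, h₂]
    rw [Matrix.range_cons_cons_empty, hgen] at h
    exact Subgroup.topEquiv.symm.injective.countable
  have : Countable (ℤ ×ₗ G) := inferInstanceAs (Countable (ℤ × G))
  have : Nonempty (ℤ ×ₗ G) := inferInstanceAs (Nonempty (ℤ × G))
  obtain ⟨Φ, hΦ⟩ := exists_injective_orderIso_to_homeoPlusI (ℤ ×ₗ G)
  let L := leftTranslation hlt
  let a : ℤ → ℤ := fun j => if j = 0 ∨ j = 1 then 1 else 0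
  have ha (l : ℤ) : a (2 * l) = if l = 0 then 1 else 0 := if_congr (by lia) rfl rfl
  have hα (k : ℤ) (hk : L h₁ ^ k = 1) : k = 0 := by
    rw [← map_zpow] at hk
    have h1 : h₁ ^ k = 1 := leftTranslation_injective hlt (hk.trans (map_one _).symm)
    have h2 := congrArg (fun x => (ε x).toAdd.1) h1
    simpa [hε₁] using h2
  refine ⟨_, isSquareRoot_alternatingCells (L h₂) hα ha Φ hΦ, ?_⟩
  set f := alternatingCells (L h₁) (L h₂) a with hf
  set g := cellShift G (Multiplicative.ofAdd 1)
  -- Cell 1 carries the faithful action. On cell 0 only `f` acts, by `h₁`; on cell 2 only `g * f *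
  -- g⁻¹`, by `h₂`. The exponent sums from `ε` make these side effects homomorphisms.
  let c : G →* (ℤ → (G ≃o G)) :=
    { toFun := fun x j => if j = 0 then L h₁ ^ (ε x).toAdd.2 else if j = 1 then L x else
        if j = 2 then L h₂ ^ (ε x).toAdd.1 else 1
      map_one' := by
        funext j
        simp
      map_mul' := fun x y => by
        funext j
        simp only [Pi.mul_apply]
        split_ifs <;> simp [zpow_add] }
  have hc (x : G) (j : ℤ) : c x j = if j = 0 then L h₁ ^ (ε x).toAdd.2 else if j = 1 then L x else
        if j = 2 then L h₂ ^ (ε x).toAdd.1 else 1 := rfl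
  have hc₂ : cellMap (c h₂) = f := by
    refine congrArg cellMap (funext fun j => ?_)
    rw [hc, hε₂]
    rcases eq_or_ne j 0 with rfl | h0
    · simp [alternating, a]
    rcases eq_or_ne j 1 with rfl | h1
    · simp [alternating, a]
    · simp [a, h0, h1]
  have hc₁ : cellMap (c h₁) = g * f * g⁻¹ := by
    rw [hf, alternatingCells, cellShift_conj_cellMap]
    refine congrArg cellMap (funext fun j => ?_)
    rw [hc, hε₁, toAdd_ofAdd]
    rcases eq_or_ne j 1 with rfl | h0
    · simp [alternating, a]
    rcases eq_or_ne j 2 with rfl | h1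
    · simp [alternating, a]
    · have h3 : j - 1 ≠ 0 := by lia
      have h4 : j - 1 ≠ 1 := by lia
      simp [a, h0, h1, h3, h4]
  have hfK : Φ f ∈ Subgroup.closure (Set.range ![Φ f, Φ g]) := Subgroup.subset_closure ⟨0, rfl⟩
  have hgK : Φ g ∈ Subgroup.closure (Set.range ![Φ f, Φ g]) := Subgroup.subset_closure ⟨1, rfl⟩
  let ψ : G →* HomeoPlusI := Φ.comp (cellMap.comp c)
  have hψ (x : G) : ψ x ∈ Subgroup.closure (Set.range ![Φ f, Φ g]) := by
    suffices h : Subgroup.closure {h₁, h₂} ≤ (Subgroup.closure (Set.range ![Φ f, Φ g])).comap ψ by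
      rw [hgen] at h
      exact h (Subgroup.mem_top x)
    rw [Subgroup.closure_le]
    have hψ₁ : ψ h₁ = Φ g * Φ f * (Φ g)⁻¹ := by
      rw [← map_inv, ← map_mul, ← map_mul, ← hc₁]
      rfl
    have hψ₂ : ψ h₂ = Φ f := congrArg Φ hc₂
    rintro _ (rfl | rfl)
    · rw [SetLike.mem_coe, Subgroup.mem_comap, hψ₁]
      exact mul_mem (mul_mem hgK hfK) (inv_mem hgK)
    · rwa [SetLike.mem_coe, Subgroup.mem_comap, hψ₂]
  refine ⟨ψ.codRestrict _ hψ, fun x y hxy => ?_⟩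
  have h1 : ψ x = ψ y := congrArg Subtype.val hxy
  have h2 := congrFun (cellMap_injective (hΦ h1)) 1
  exact leftTranslation_injective hlt h2

/-! ### Uncountably many isomorphism types. -/

/-- The set of `k` such that `x` does not commute with its conjugate by `y ^ (2 * k + 1)`. -/
def noncommutingShifts {Γ : Type*} [Group Γ] (x y : Γ) : Set ℕ :=
  {k | ¬ Commute x (y ^ (2 * k + 1) * x * (y ^ (2 * k + 1))⁻¹)}

theorem noncommutingShifts_map {Γ Γ' : Type*} [Group Γ] [Group Γ'] {θ : Γ →* Γ'}
    (hθ : Function.Injective θ) (x y : Γ) :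
    noncommutingShifts (θ x) (θ y) = noncommutingShifts x y := by
  ext k
  simp only [noncommutingShifts, Set.mem_ofPred_eq, ← map_pow, ← map_mul, ← map_inv]
  rw [not_iff_not]
  exact ⟨fun h => hθ (by simpa only [map_mul] using h.eq), fun h => h.map θ⟩

open Classical in
/-- The indicator function of `{0} ∪ {2 * k + 1 | k ∈ S}`. -/
noncomputable def oddIndicator (S : Set ℕ) (j : ℤ) : ℤ :=
  if j = 0 ∨ ∃ k ∈ S, j = 2 * k + 1 then 1 else 0

theorem oddIndicator_two_mul (S : Set ℕ) (l : ℤ) :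
    oddIndicator S (2 * l) = if l = 0 then 1 else 0 := by
  classical
  refine if_congr ⟨?_, by lia⟩ rfl rfl
  rintro (h | ⟨k, -, h⟩) <;> lia

theorem oddIndicator_two_mul_add_one (S : Set ℕ) (k : ℕ) [Decidable (k ∈ S)] :
    oddIndicator S (2 * k + 1) = if k ∈ S then 1 else 0 := by
  classical
  refine if_congr ⟨?_, fun h => .inr ⟨k, h, rfl⟩⟩ rfl rfl
  rintro (h | ⟨k', hk', h⟩)
  · lia
  · obtain rfl : k = k' := by lia
    exact hk'

/-- An odd shift swaps parities, so `α` can meet `β` only on cells 0 and `2 * k + 1`. On cell 0 the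
conjugate has exponent `a (-(2 * k + 1)) = 0`; on cell `2 * k + 1` it acts by `α`, against `β`
exactly when `k ∈ S`. -/
theorem noncommutingShifts_alternatingCells {X : Type*} [LinearOrder X] [Nonempty X]
    {α β : X ≃o X} (hαβ : ¬ Commute α β) (S : Set ℕ) :
    noncommutingShifts (alternatingCells α β (oddIndicator S))
      (cellShift X (Multiplicative.ofAdd 1)) = S := by
  classical
  ext k
  rw [noncommutingShifts, Set.mem_ofPred_eq, ← map_pow, alternatingCells, cellShift_conj_cellMap,
    ← ofAdd_nsmul, toAdd_ofAdd, not_iff_comm, commute_iff_eq, ← map_mul, ← map_mul,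
    cellMap_injective.eq_iff, funext_iff]
  have hk : ((2 * k + 1) • (1 : ℤ)) = 2 * k + 1 := by simp
  simp only [Pi.mul_apply, hk]
  constructor
  · intro hkS j
    obtain ⟨l, rfl | rfl⟩ := Int.even_or_odd' j
    · rw [oddIndicator_two_mul]
      split_ifs with hl
      · have : oddIndicator S (2 * l - (2 * k + 1)) = 0 := by
          refine if_neg ?_
          rintro (h | ⟨k', -, h⟩) <;> lia
        simp [this]
      · simp
    · rw [show 2 * l + 1 - (2 * k + 1) = 2 * (l - k) by ring, oddIndicator_two_mul]
      split_ifs with hl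
      · obtain rfl : l = k := by lia
        rw [oddIndicator_two_mul_add_one, if_neg hkS]
        simp
      · simp
  · intro h hkS
    have hodd : ¬ Even (2 * (k : ℤ) + 1) := Int.not_even_two_mul_add_one k
    have := h (2 * k + 1)
    rw [sub_self, oddIndicator_two_mul_add_one, if_pos hkS] at this
    refine hαβ (commute_iff_eq _ _ |>.2 ?_)
    simpa only [alternating, hodd, oddIndicator, true_or, if_true, if_false, Even.zero, zpow_one]
      using this.symm

theorem uncountable_squareRootIso_lampGen : Uncountable (Quotient (squareRootIso lampGen)) := by
  by_contra hcount
  rw [not_uncountable_iff] at hcount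
  have : Countable (ℤ ×ₗ ℚ) := inferInstanceAs (Countable (ℤ × ℚ))
  have : Nonempty (ℤ ×ₗ ℚ) := inferInstanceAs (Nonempty (ℤ × ℚ))
  obtain ⟨Φ, hΦ⟩ := exists_injective_orderIso_to_homeoPlusI (ℤ ×ₗ ℚ)
  let α : ℚ ≃o ℚ := OrderIso.addRight 1
  let β : ℚ ≃o ℚ := OrderIso.mulRight₀ 2 (by norm_num)
  have hαβ : ¬ Commute α β := fun h => by
    have : (0 * 2 + 1 : ℚ) = (0 + 1) * 2 := DFunLike.congr_fun h.eq 0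
    norm_num at this
  have hα (k : ℤ) (hk : α ^ k = 1) : k = 0 := by
    have h (n : ℕ) (x : ℚ) : (α ^ n) x = x + n := by
      induction n generalizing x with
      | zero => simp
      | succ n ih =>
        rw [pow_succ, RelIso.mul_apply, ih]
        change x + 1 + n = _
        push_cast
        ring
    rw [← Int.natAbs_eq_zero]
    have h1 := h k.natAbs 0
    have h2 : α ^ k.natAbs = 1 := pow_natAbs_eq_one.2 hk
    rw [h2, RelIso.one_apply, zero_add] at h1
    exact_mod_cast h1.symm
  let Q := Quotient (squareRootIso lampGen)
  have hQ (q : Q) : Countable q.out.1 := by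
    obtain ⟨g, hg, -⟩ := q.out.2
    rw [← hg]
    exact countable_closure_range g
  -- A countable domain: countably many types, each with countably many pairs of elements.
  -- Surjectivity contradicts Cantor's theorem.
  let Ψ : (Σ q : Q, q.out.1 × q.out.1) → Set ℕ := fun p => noncommutingShifts p.2.1 p.2.2
  have hΨ : Function.Surjective Ψ := fun S => by
    let K : {K : Subgroup HomeoPlusI // IsSquareRoot lampGen K} :=
      ⟨_, isSquareRoot_alternatingCells β hα (oddIndicator_two_mul S) Φ hΦ⟩
    obtain ⟨e⟩ : Nonempty (K.1 ≃* (Quotient.mk (squareRootIso lampGen) K).out.1) :=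
      (squareRootIso lampGen).symm (Quotient.mk_out K)
    let x : K.1 := ⟨_, Subgroup.subset_closure ⟨0, rfl⟩⟩
    let y : K.1 := ⟨_, Subgroup.subset_closure ⟨1, rfl⟩⟩
    refine ⟨⟨Quotient.mk _ K, e x, e y⟩, ?_⟩
    refine (noncommutingShifts_map (θ := e.toMonoidHom) e.injective x y).trans ?_
    refine (noncommutingShifts_map (θ := K.1.subtype) K.1.subtype_injective x y).symm.trans ?_
    refine (noncommutingShifts_map hΦ _ _).trans ?_
    exact noncommutingShifts_alternatingCells hαβ S
  have := hΨ.countable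
  obtain ⟨F, hF⟩ := exists_injective_nat (Set ℕ)
  exact Function.cantor_injective F hF

/-- Every left orderable marked extension of `P` embeds in a square root of the lamplighter group
`ℤ ≀ ℤ` with its standard generators, and the square roots of `ℤ ≀ ℤ` fall into uncountably many
isomorphism types of groups. -/
theorem theorem4p2 :
    (∀ (G : Type*) [Group G] (h₁ h₂ : G), IsMarkedExtensionOfP h₁ h₂ → IsLeftOrderable G →
      ∃ K : Subgroup HomeoPlusI, IsSquareRoot lampGen K ∧
        ∃ φ : G →* K, Function.Injective φ) ∧
    Uncountable (Quotient (squareRootIso lampGen)) :=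
  ⟨fun _ _ _ _ hP hG =>
    have ⟨_, hε₁, hε₂⟩ := hP.exists_hom_int
    exists_squareRoot_lampGen_of_hom_int hP.1 hG hε₁ hε₂,
    uncountable_squareRootIso_lampGen⟩
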